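/- Let $A$ be an $f$-algebra, that is, a real Riesz space with an associative bilinear multiplication (not necessarily unital) such that $ab\ge 0$ whenever $a,b\ge 0$, and such that $a\wedge b=0$, $c\ge 0$ imply $(ca)\wedge b=(ac)\wedge b=0$. Let $A^{\sim}$ be the order dual of $A$ (the Riesz space of order bounded linear functionals on $A$) and assume that $A^{\sim}$ separates the points of $A$. Let $(A^{\sim})^{\sim}_n$ be the space of order continuous functionals in the order dual of $A^{\sim}$. For $f\in A^{\sim}$, $a\in A$ and $F\in (A^{\sim})^{\sim}_n$ define $f\cdot a\in A^{\sim}$ and $F\cdot f\in A^{\sim}$ by $$(f\cdot a)(b)=f(ab)\quad(b\in A),\qquad (F\cdot f)(a)=F(f\cdot a)\quad(a\in A),$$ and put $R(f)=\{F\cdot f: F\in (A^{\sim})^{\sim}_n\}$. An order bounded linear operator $T:A^{\sim}\to A^{\sim}$ is called $f$-linear with respect to $(A^{\sim})^{\sim}_n$ if $T(G\cdot f)=G\cdot T(f)$ for all $f\in A^{\sim}$ and $G\in (A^{\sim})^{\sim}_n$; it is called an $f$-orthomorphism on $A^{\sim}$ if $R(Tf)\subseteq R(f)$ for every $f\in A^{\sim}$.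 Theorem. Every order bounded operator on $A^{\sim}$ that is $f$-linear with respect to $(A^{\sim})^{\sim}_n$ is an $f$-orthomorphism, i.e. $$L_{b}(A^{\sim},A^{\sim};(A^{\sim})^{\sim}_{n})\subseteq \mathrm{Orth}(A^{\sim},A^{\sim};(A^{\sim})^{\sim}_{n}).$$ -/

import Mathlib

open Filter Topology

noncomputable section

set_option linter.unusedSectionVars false

/-! Throughout, a (real) Riesz space is a type `E` with
`[AddCommGroup E] [Module ℝ E] [Lattice E] [IsOrderedAddMonoid E] [IsOrderedModule ℝ E]`. -/

/-- A linear map between ordered vector spaces is order bounded if it maps order bounded sets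
to order bounded sets. -/
def IsOrderBoundedMap {E F : Type*} [AddCommGroup E] [Module ℝ E] [Preorder E]
    [AddCommGroup F] [Module ℝ F] [Preorder F] (T : E →ₗ[ℝ] F) : Prop :=
  ∀ s : Set E, BddBelow s → BddAbove s → BddBelow (T '' s) ∧ BddAbove (T '' s)

/-- The order bounded linear functionals, as a subspace of the algebraic dual. -/
def orderBoundedFunctionals (E : Type*) [AddCommGroup E] [Module ℝ E] [Preorder E] :
    Submodule ℝ (E →ₗ[ℝ] ℝ) where
  carrier := {f | IsOrderBoundedMap f}
  zero_mem' := by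
    intro s _ _
    constructor
    · exact ⟨0, by rintro _ ⟨x, _, rfl⟩; simp⟩
    · exact ⟨0, by rintro _ ⟨x, _, rfl⟩; simp⟩
  add_mem' := by
    intro f g hf hg s h1 h2
    obtain ⟨⟨a, ha⟩, b, hb⟩ := hf s h1 h2
    obtain ⟨⟨c, hc⟩, d, hd⟩ := hg s h1 h2
    constructor
    · refine ⟨a + c, ?_⟩
      rintro _ ⟨x, hx, rfl⟩
      exact add_le_add (ha ⟨x, hx, rfl⟩) (hc ⟨x, hx, rfl⟩)
    · refine ⟨b + d, ?_⟩
      rintro _ ⟨x, hx, rfl⟩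
      exact add_le_add (hb ⟨x, hx, rfl⟩) (hd ⟨x, hx, rfl⟩)
  smul_mem' := by
    intro t f hf s h1 h2
    obtain ⟨⟨a, ha⟩, b, hb⟩ := hf s h1 h2
    rcases le_total 0 t with ht | ht
    · constructor
      · refine ⟨t * a, ?_⟩
        rintro _ ⟨x, hx, rfl⟩
        exact mul_le_mul_of_nonneg_left (ha ⟨x, hx, rfl⟩) ht
      · refine ⟨t * b, ?_⟩
        rintro _ ⟨x, hx, rfl⟩
        exact mul_le_mul_of_nonneg_left (hb ⟨x, hx, rfl⟩) ht
    · constructor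
      · refine ⟨t * b, ?_⟩
        rintro _ ⟨x, hx, rfl⟩
        exact mul_le_mul_of_nonpos_left (hb ⟨x, hx, rfl⟩) ht
      · refine ⟨t * a, ?_⟩
        rintro _ ⟨x, hx, rfl⟩
        exact mul_le_mul_of_nonpos_left (ha ⟨x, hx, rfl⟩) ht

/-- The order dual `E^~` of `E`: the space of order bounded linear functionals on `E`. -/
def RieszDual (E : Type*) [AddCommGroup E] [Module ℝ E] [Preorder E] : Type _ :=
  ↥(orderBoundedFunctionals E)

namespace RieszDual

section Basic

variable {E : Type*} [AddCommGroup E] [Module ℝ E] [Preorder E]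

instance : AddCommGroup (RieszDual E) := inferInstanceAs (AddCommGroup ↥(orderBoundedFunctionals E))

instance : Module ℝ (RieszDual E) := inferInstanceAs (Module ℝ ↥(orderBoundedFunctionals E))

/-- The underlying linear functional of an element of the order dual. -/
def toLin (f : RieszDual E) : E →ₗ[ℝ] ℝ := f.1

/-- An order bounded linear functional, as an element of the order dual. -/
def ofLin (f : E →ₗ[ℝ] ℝ) (hf : IsOrderBoundedMap f) : RieszDual E := ⟨f, hf⟩

instance : CoeFun (RieszDual E) (fun _ => E → ℝ) := ⟨fun f => f.toLin⟩

theorem isOrderBoundedMap (f : RieszDual E) : IsOrderBoundedMap f.toLin := f.2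

@[simp] theorem ofLin_apply (f : E →ₗ[ℝ] ℝ) (hf : IsOrderBoundedMap f) (x : E) :
    (ofLin f hf) x = f x := rfl

@[simp] theorem toLin_ofLin (f : E →ₗ[ℝ] ℝ) (hf : IsOrderBoundedMap f) :
    (ofLin f hf).toLin = f := rfl

@[simp] theorem add_apply (f g : RieszDual E) (x : E) : (f + g) x = f x + g x := rfl

@[simp] theorem neg_apply (f : RieszDual E) (x : E) : (-f) x = -f x := rfl

@[simp] theorem sub_apply (f g : RieszDual E) (x : E) : (f - g) x = f x - g x := rfl

@[simp] theorem zero_apply (x : E) : (0 : RieszDual E) x = 0 := rfl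

@[simp] theorem smul_apply (t : ℝ) (f : RieszDual E) (x : E) : (t • f) x = t * f x := rfl

theorem ext {f g : RieszDual E} (h : ∀ x, f x = g x) : f = g :=
  Subtype.ext (LinearMap.ext h)

end Basic

section Order

variable {E : Type*} [AddCommGroup E] [Module ℝ E] [Lattice E] [IsOrderedAddMonoid E]

/-- The order of `E^~`: `f ≤ g` iff `f x ≤ g x` for all `x ≥ 0`. -/
instance : PartialOrder (RieszDual E) where
  le f g := ∀ x : E, 0 ≤ x → f x ≤ g x
  le_refl f x _ := le_refl _
  le_trans f g h h1 h2 x hx := (h1 x hx).trans (h2 x hx)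
  le_antisymm f g h1 h2 := by
    have key : ∀ x : E, 0 ≤ x → f x = g x := fun x hx => le_antisymm (h1 x hx) (h2 x hx)
    apply RieszDual.ext
    intro x
    rw [← posPart_sub_negPart x, map_sub, map_sub, key _ (posPart_nonneg x),
      key _ (negPart_nonneg x)]

theorem le_def {f g : RieszDual E} : f ≤ g ↔ ∀ x : E, 0 ≤ x → f x ≤ g x := Iff.rfl

instance : IsOrderedAddMonoid (RieszDual E) where
  add_le_add_left f g h k x hx := by
    simpa using h x hx

instance : IsOrderedModule ℝ (RieszDual E) where
  smul_le_smul_of_nonneg_left _t ht _f _g h x hx := mul_le_mul_of_nonneg_left (h x hx) ht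
  smul_le_smul_of_nonneg_right _f hf _s _t h x hx := mul_le_mul_of_nonneg_right h (hf x hx)

end Order

section RieszKantorovich

variable {E : Type*} [AddCommGroup E] [Module ℝ E] [Lattice E] [IsOrderedAddMonoid E]
  [IsOrderedModule ℝ E]

/-- The Riesz–Kantorovich formula `f⁺(x) = sup {f y : 0 ≤ y ≤ x}`, for `x ≥ 0`. -/
def posAux (f : RieszDual E) (x : E) : ℝ := sSup (f '' Set.Icc 0 x)

theorem bddAbove_posAux (f : RieszDual E) (x : E) : BddAbove (f '' Set.Icc 0 x) :=
  (f.isOrderBoundedMap _ bddBelow_Icc bddAbove_Icc).2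

theorem le_posAux (f : RieszDual E) {x y : E} (h0 : 0 ≤ y) (h1 : y ≤ x) : f y ≤ posAux f x :=
  le_csSup (bddAbove_posAux f x) ⟨y, ⟨h0, h1⟩, rfl⟩

theorem posAux_le (f : RieszDual E) {x : E} (hx : 0 ≤ x) {c : ℝ}
    (h : ∀ y, 0 ≤ y → y ≤ x → f y ≤ c) : posAux f x ≤ c := by
  refine csSup_le ⟨f 0, 0, ⟨le_refl _, hx⟩, rfl⟩ ?_
  rintro _ ⟨y, hy, rfl⟩
  exact h y hy.1 hy.2

theorem posAux_nonneg (f : RieszDual E) {x : E} (hx : 0 ≤ x) : 0 ≤ posAux f x := by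
  have := le_posAux f (le_refl (0 : E)) hx
  simpa using this

theorem posAux_add (f : RieszDual E) {x y : E} (hx : 0 ≤ x) (hy : 0 ≤ y) :
    posAux f (x + y) = posAux f x + posAux f y := by
  apply le_antisymm
  · refine posAux_le f (add_nonneg hx hy) fun w h0 h1 => ?_
    have e : f w = f (w ⊓ x) + f (w - w ⊓ x) := by rw [← map_add]; congr 1; abel
    rw [e]
    refine add_le_add (le_posAux f (le_inf h0 hx) inf_le_right)
      (le_posAux f (sub_nonneg.2 inf_le_left) ?_)
    rw [sub_le_iff_le_add, add_comm, inf_add]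
    exact le_inf (le_add_of_nonneg_right hy) h1
  · rw [← le_sub_iff_add_le]
    refine posAux_le f hx fun u hu0 hu1 => ?_
    rw [le_sub_comm]
    refine posAux_le f hy fun v hv0 hv1 => ?_
    rw [le_sub_iff_add_le, ← map_add]
    exact le_posAux f (add_nonneg hv0 hu0) (by rw [add_comm]; exact add_le_add hu1 hv1)

theorem posAux_smul_le (f : RieszDual E) {x : E} (hx : 0 ≤ x) {t : ℝ} (ht : 0 < t) :
    t * posAux f x ≤ posAux f (t • x) := by
  rw [← le_div_iff₀' ht]
  refine posAux_le f hx fun y h0 h1 => ?_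
  rw [le_div_iff₀' ht]
  have := le_posAux f (smul_nonneg ht.le h0) (smul_le_smul_of_nonneg_left h1 ht.le)
  simpa using this

theorem posAux_smul (f : RieszDual E) {x : E} (hx : 0 ≤ x) {t : ℝ} (ht : 0 ≤ t) :
    posAux f (t • x) = t * posAux f x := by
  rcases ht.eq_or_lt with rfl | ht
  · have := posAux_add f (le_refl (0 : E)) (le_refl (0 : E))
    simp only [add_zero] at this
    simp only [zero_smul, zero_mul]
    linarith
  · refine le_antisymm ?_ (posAux_smul_le f hx ht)
    have := posAux_smul_le f (smul_nonneg ht.le hx) (inv_pos.2 ht)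
    rw [smul_smul, inv_mul_cancel₀ ht.ne', one_smul] at this
    rwa [inv_mul_le_iff₀ ht] at this

theorem posAux_sub_eq (f : RieszDual E) {a b c d : E} (ha : 0 ≤ a) (hb : 0 ≤ b) (hc : 0 ≤ c)
    (hd : 0 ≤ d) (h : a - b = c - d) :
    posAux f a - posAux f b = posAux f c - posAux f d := by
  have e : a + d = c + b := by rwa [sub_eq_sub_iff_add_eq_add] at h
  have := posAux_add f ha hd
  rw [e, posAux_add f hc hb] at this
  linarith

/-- The linear extension of `posAux f` from the positive cone. -/
def posLin (f : RieszDual E) : E →ₗ[ℝ] ℝ where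
  toFun x := posAux f x⁺ - posAux f x⁻
  map_add' x y := by
    have h := posAux_sub_eq f (posPart_nonneg (x + y)) (negPart_nonneg (x + y))
      (add_nonneg (posPart_nonneg x) (posPart_nonneg y))
      (add_nonneg (negPart_nonneg x) (negPart_nonneg y))
      (by rw [posPart_sub_negPart, add_sub_add_comm, posPart_sub_negPart, posPart_sub_negPart])
    rw [h, posAux_add f (posPart_nonneg x) (posPart_nonneg y),
      posAux_add f (negPart_nonneg x) (negPart_nonneg y)]
    ring
  map_smul' t x := by
    simp only [RingHom.id_apply, smul_eq_mul]
    rcases le_total 0 t with ht | ht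
    · rw [posAux_sub_eq f (posPart_nonneg (t • x)) (negPart_nonneg (t • x))
        (smul_nonneg ht (posPart_nonneg x)) (smul_nonneg ht (negPart_nonneg x))
        (by rw [posPart_sub_negPart, ← smul_sub, posPart_sub_negPart]),
        posAux_smul f (posPart_nonneg x) ht, posAux_smul f (negPart_nonneg x) ht]
      ring
    · have ht' : 0 ≤ -t := neg_nonneg.2 ht
      rw [posAux_sub_eq f (posPart_nonneg (t • x)) (negPart_nonneg (t • x))
        (smul_nonneg ht' (negPart_nonneg x)) (smul_nonneg ht' (posPart_nonneg x))
        (by rw [posPart_sub_negPart, ← smul_sub, ← neg_sub, posPart_sub_negPart, smul_neg,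
              neg_smul, neg_neg]),
        posAux_smul f (posPart_nonneg x) ht', posAux_smul f (negPart_nonneg x) ht']
      ring

theorem posLin_apply (f : RieszDual E) {x : E} (hx : 0 ≤ x) : posLin f x = posAux f x := by
  have h0 : posAux f 0 = 0 := by
    have := posAux_smul f (le_refl (0 : E)) (le_refl (0 : ℝ))
    simpa using this
  change posAux f x⁺ - posAux f x⁻ = _
  rw [posPart_of_nonneg hx, negPart_of_nonneg hx, h0, sub_zero]

theorem isOrderBoundedMap_of_nonneg {F : Type*} [AddCommGroup F] [Module ℝ F] [Preorder F]
    [AddLeftMono F] (T : E →ₗ[ℝ] F) (hT : ∀ x, 0 ≤ x → 0 ≤ T x) : IsOrderBoundedMap T := by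
  have mono : ∀ x y, x ≤ y → T x ≤ T y := by
    intro x y h
    have h2 := add_le_add_right (hT (y - x) (sub_nonneg.2 h)) (T x)
    rwa [add_zero, ← map_add, add_sub_cancel] at h2
  rintro s ⟨l, hl⟩ ⟨u, hu⟩
  constructor
  · refine ⟨T l, ?_⟩
    rintro _ ⟨x, hx, rfl⟩
    exact mono _ _ (hl hx)
  · refine ⟨T u, ?_⟩
    rintro _ ⟨x, hx, rfl⟩
    exact mono _ _ (hu hx)

/-- `f ⊔ 0` in the order dual. -/
def pos (f : RieszDual E) : RieszDual E :=
  ofLin (posLin f) (isOrderBoundedMap_of_nonneg _ fun x hx => by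
    rw [posLin_apply f hx]; exact posAux_nonneg f hx)

theorem pos_apply (f : RieszDual E) {x : E} (hx : 0 ≤ x) : pos f x = posAux f x :=
  posLin_apply f hx

theorem pos_nonneg (f : RieszDual E) : 0 ≤ pos f := fun x hx => by
  rw [pos_apply f hx]; exact posAux_nonneg f hx

theorem le_pos (f : RieszDual E) : f ≤ pos f := fun x hx => by
  rw [pos_apply f hx]; exact le_posAux f hx (le_refl x)

theorem pos_le {f g : RieszDual E} (hg : 0 ≤ g) (h : f ≤ g) : pos f ≤ g := fun x hx => by
  rw [pos_apply f hx]
  refine posAux_le f hx fun y h0 h1 => (h y h0).trans ?_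
  have := hg (x - y) (sub_nonneg.2 h1)
  rw [map_sub] at this
  simpa using this

/-- The order dual of a Riesz space is a Riesz space. -/
instance : Lattice (RieszDual E) where
  sup f g := f + pos (g - f)
  inf f g := f - pos (f - g)
  le_sup_left f g := le_add_of_nonneg_right (pos_nonneg _)
  le_sup_right f g := by
    have := add_le_add_right (le_pos (g - f)) f
    rwa [add_sub_cancel] at this
  sup_le f g h h1 h2 := by
    have := add_le_add_right (pos_le (sub_nonneg.2 h1) (sub_le_sub_right h2 f)) f
    rwa [add_sub_cancel] at this
  inf_le_left f g := sub_le_self _ (pos_nonneg _)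
  inf_le_right f g := by
    have := sub_le_sub_left (le_pos (f - g)) f
    rwa [sub_sub_cancel] at this
  le_inf h f g h1 h2 := by
    have := sub_le_sub_left (pos_le (sub_nonneg.2 h1) (sub_le_sub_left h2 f)) f
    rwa [sub_sub_cancel] at this

end RieszKantorovich

end RieszDual

/-- A net `x` in a Riesz space converges in order to `0`: there is a net `y ↓ 0` over the same
index set with `|x i| ≤ y i` for all `i`. -/
def OrderTendstoZero {E ι : Type*} [AddCommGroup E] [Lattice E] [Preorder ι] (x : ι → E) : Prop :=
  ∃ y : ι → E, Antitone y ∧ IsGLB (Set.range y) 0 ∧ ∀ i, |x i| ≤ y i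

/-- `E^~_n`: the order continuous elements of the order dual, i.e. those which map nets that
converge in order to `0` to nets that converge to `0`. -/
def orderContinuousDual.{u} (E : Type u) [AddCommGroup E] [Module ℝ E] [Lattice E] :
    Submodule ℝ (RieszDual E) where
  carrier := {F | ∀ (ι : Type u) [Preorder ι] [IsDirected ι (· ≤ ·)] [Nonempty ι] (x : ι → E),
    OrderTendstoZero x → Tendsto (fun i => F (x i)) atTop (𝓝 0)}
  zero_mem' := by
    intro ι _ _ _ x _
    simp
  add_mem' := by
    intro F G hF hG ι _ _ _ x hx
    simpa using (hF ι x hx).add (hG ι x hx)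
  smul_mem' := by
    intro t F hF ι _ _ _ x hx
    simpa using (hF ι x hx).const_mul t

/-- `f`-algebras: Riesz spaces with an associative multiplication (not necessarily unital) such
that products of positive elements are positive and `a ⊓ b = 0`, `0 ≤ c` imply
`(c * a) ⊓ b = 0` and `(a * c) ⊓ b = 0`. -/
class IsFAlgebra (A : Type*) [NonUnitalRing A] [Module ℝ A] [IsScalarTower ℝ A A]
    [SMulCommClass ℝ A A] [Lattice A] [IsOrderedAddMonoid A] [IsOrderedModule ℝ A] : Prop where
  mul_nonneg : ∀ a b : A, 0 ≤ a → 0 ≤ b → 0 ≤ a * b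
  mul_left_inf : ∀ a b c : A, a ⊓ b = 0 → 0 ≤ c → (c * a) ⊓ b = 0
  mul_right_inf : ∀ a b c : A, a ⊓ b = 0 → 0 ≤ c → (a * c) ⊓ b = 0

/-- The order dual of `E` separates the points of `E`. -/
def HasSeparatingOrderDual (E : Type*) [AddCommGroup E] [Module ℝ E] [Preorder E] : Prop :=
  ∀ x : E, (∀ f : RieszDual E, f x = 0) → x = 0

section FAlgebra

theorem IsOrderBoundedMap.comp {E F G : Type*} [AddCommGroup E] [Module ℝ E] [Preorder E]
    [AddCommGroup F] [Module ℝ F] [Preorder F] [AddCommGroup G] [Module ℝ G] [Preorder G]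
    {S : F →ₗ[ℝ] G} {T : E →ₗ[ℝ] F} (hS : IsOrderBoundedMap S) (hT : IsOrderBoundedMap T) :
    IsOrderBoundedMap (S ∘ₗ T) := by
  intro s h1 h2
  obtain ⟨h3, h4⟩ := hT s h1 h2
  have := hS _ h3 h4
  rwa [← Set.image_comp] at this

theorem IsOrderBoundedMap.sub {E F : Type*} [AddCommGroup E] [Module ℝ E] [Preorder E]
    [AddCommGroup F] [Module ℝ F] [Lattice F] [IsOrderedAddMonoid F]
    {S T : E →ₗ[ℝ] F} (hS : IsOrderBoundedMap S) (hT : IsOrderBoundedMap T) :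
    IsOrderBoundedMap (S - T) := by
  intro s h1 h2
  obtain ⟨⟨a, ha⟩, b, hb⟩ := hS s h1 h2
  obtain ⟨⟨c, hc⟩, d, hd⟩ := hT s h1 h2
  constructor
  · refine ⟨a - d, ?_⟩
    rintro _ ⟨x, hx, rfl⟩
    exact sub_le_sub (ha ⟨x, hx, rfl⟩) (hd ⟨x, hx, rfl⟩)
  · refine ⟨b - c, ?_⟩
    rintro _ ⟨x, hx, rfl⟩
    exact sub_le_sub (hb ⟨x, hx, rfl⟩) (hc ⟨x, hx, rfl⟩)

variable {A : Type*} [NonUnitalRing A] [Module ℝ A] [IsScalarTower ℝ A A]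
  [SMulCommClass ℝ A A] [Lattice A] [IsOrderedAddMonoid A] [IsOrderedModule ℝ A] [IsFAlgebra A]

theorem isOrderBoundedMap_mulLeft (a : A) : IsOrderBoundedMap (LinearMap.mulLeft ℝ a) := by
  have e : LinearMap.mulLeft ℝ a = LinearMap.mulLeft ℝ a⁺ - LinearMap.mulLeft ℝ a⁻ := by
    ext x
    simp [← sub_mul]
  rw [e]
  exact (RieszDual.isOrderBoundedMap_of_nonneg _ fun x hx =>
    IsFAlgebra.mul_nonneg _ _ (posPart_nonneg a) hx).sub
    (RieszDual.isOrderBoundedMap_of_nonneg _ fun x hx =>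
    IsFAlgebra.mul_nonneg _ _ (negPart_nonneg a) hx)

/-- `f · a`, the element of `A^~` given by `(f · a) b = f (a * b)`. -/
def dualMul (f : RieszDual A) (a : A) : RieszDual A :=
  RieszDual.ofLin (f.toLin ∘ₗ LinearMap.mulLeft ℝ a)
    (f.isOrderBoundedMap.comp (isOrderBoundedMap_mulLeft a))

@[simp] theorem dualMul_apply (f : RieszDual A) (a b : A) : dualMul f a b = f (a * b) := rfl

/-- The linear map `a ↦ f · a` from `A` to `A^~`. -/
def dualMulLin (f : RieszDual A) : A →ₗ[ℝ] RieszDual A where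
  toFun a := dualMul f a
  map_add' a b := RieszDual.ext fun x => by simp [add_mul]
  map_smul' t a := RieszDual.ext fun x => by simp [smul_mul_assoc]

theorem isOrderBoundedMap_dualMulLin (f : RieszDual A) : IsOrderBoundedMap (dualMulLin f) := by
  have nn : ∀ g : RieszDual A, 0 ≤ g → IsOrderBoundedMap (dualMulLin g) := fun g hg =>
    RieszDual.isOrderBoundedMap_of_nonneg _ fun a ha x hx =>
      hg (a * x) (IsFAlgebra.mul_nonneg _ _ ha hx)
  have e : dualMulLin f = dualMulLin f⁺ - dualMulLin f⁻ := by
    refine LinearMap.ext fun a => RieszDual.ext fun x => ?_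
    change f (a * x) = f⁺ (a * x) - f⁻ (a * x)
    rw [← RieszDual.sub_apply, posPart_sub_negPart]
  rw [e]
  exact (nn _ (posPart_nonneg f)).sub (nn _ (negPart_nonneg f))

/-- `F · f`, the element of `A^~` given by `(F · f) a = F (f · a)`. -/
def bidualMul (F : RieszDual (RieszDual A)) (f : RieszDual A) : RieszDual A :=
  RieszDual.ofLin (F.toLin ∘ₗ dualMulLin f)
    (F.isOrderBoundedMap.comp (isOrderBoundedMap_dualMulLin f))

@[simp] theorem bidualMul_apply (F : RieszDual (RieszDual A)) (f : RieszDual A) (a : A) :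
    bidualMul F f a = F (dualMul f a) := rfl

/-- `R(f) = {F · f : F ∈ (A^~)^~_n}`. -/
def dualRange (f : RieszDual A) : Set (RieszDual A) :=
  {g | ∃ F ∈ orderContinuousDual (RieszDual A), g = bidualMul F f}

variable (A)

/-- `L_b(A^~, A^~; (A^~)^~_n)`: the order bounded operators `T` on `A^~` that are `f`-linear with
respect to `(A^~)^~_n`, i.e. `T (G · f) = G · T f` for all `f ∈ A^~` and `G ∈ (A^~)^~_n`. -/
def fLinearOperators : Set (RieszDual A →ₗ[ℝ] RieszDual A) :=
  {T | IsOrderBoundedMap T ∧ ∀ f : RieszDual A, ∀ G ∈ orderContinuousDual (RieszDual A),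
    T (bidualMul G f) = bidualMul G (T f)}

/-- `Orth(A^~, A^~; (A^~)^~_n)`: the `f`-orthomorphisms on `A^~`, i.e. the order bounded operators
`T` on `A^~` such that `R(T f) ⊆ R(f)` for all `f ∈ A^~`. -/
def fOrthomorphisms : Set (RieszDual A →ₗ[ℝ] RieszDual A) :=
  {T | IsOrderBoundedMap T ∧ ∀ f : RieszDual A, dualRange (T f) ⊆ dualRange f}

end FAlgebra

end

noncomputable section

set_option linter.unusedSectionVars false

/-! Separation makes `A` commutative, so evaluation at `a`, an order continuous functional on the
order dual, acts by `f ↦ f · a`. An `f`-linear `T` therefore satisfies `T (f · a) = (T f) · a`, and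
`(G · T f) a = G (T (f · a))`. If `G ∘ T` were known to be order continuous, it would witness `G · T
f ∈ R(f)`. To secure this, `T` is replaced by `P ∘ T`, with `P` the band projection onto the band
`B` generated by all functionals `g · a`. Nothing is lost, because `P` fixes `(T f) · a`.

Order continuity of `P ∘ T` follows from two facts. An order bounded band preserving operator on a
Dedekind complete Riesz space is order continuous (`OrderTendstoZero.map_of_bandPreserving`). And `P
∘ T` is band preserving (`bandPreserving_comp_of_mem_fLinearOperators`): if `f ⊥ g`, put `h = |P (T
f)| ⊓ |g|` and let `Q` project onto the band of `h`. Each `F = eval b ∘ Q` is order continuous and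
kills every `f · c`, so `F · T f = T (F · f) = 0`; hence `Q (T f)` is annihilated by all of `A`.
Such functionals are disjoint from `B`, whereas `h ∈ B`, and this forces `h = 0`.

The algebraic input is that `f ↦ f · a` preserves bands and that annihilated functionals are
disjoint from every `g · a`. Both come from Archimedean estimates. -/

/-- Every nonempty set which is bounded above has a supremum. -/
def IsDedekindComplete (E : Type*) [Preorder E] : Prop :=
  ∀ s : Set E, s.Nonempty → BddAbove s → ∃ u, IsLUB s u

/-! ### Disjointness in lattice-ordered groups. -/

section LatticeGroup

variable {E : Type*} [AddCommGroup E] [Lattice E] [IsOrderedAddMonoid E]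

theorem inf_add_le_of_nonneg {a b c : E} (ha : 0 ≤ a) (hb : 0 ≤ b) (hc : 0 ≤ c) :
    a ⊓ (b + c) ≤ a ⊓ b + a ⊓ c := by
  rw [add_inf, inf_add, inf_add]
  refine le_inf (le_inf ?_ ?_) (le_inf ?_ inf_le_right)
  · exact inf_le_left.trans (le_add_of_nonneg_right ha)
  · exact inf_le_left.trans (le_add_of_nonneg_left hb)
  · exact inf_le_left.trans (le_add_of_nonneg_right hc)

theorem inf_eq_zero_mono {a b c d : E} (hc : 0 ≤ c) (hd : 0 ≤ d) (hca : c ≤ a) (hdb : d ≤ b)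
    (h : a ⊓ b = 0) : c ⊓ d = 0 :=
  le_antisymm (h ▸ inf_le_inf hca hdb) (le_inf hc hd)

theorem inf_add_eq_zero {a b c : E} (ha : 0 ≤ a) (hb : 0 ≤ b) (hc : 0 ≤ c) (h : a ⊓ b = 0)
    (h' : a ⊓ c = 0) : a ⊓ (b + c) = 0 :=
  le_antisymm ((inf_add_le_of_nonneg ha hb hc).trans (by simp [h, h']))
    (le_inf ha (add_nonneg hb hc))

theorem inf_nsmul_eq_zero {a b : E} (h : a ⊓ b = 0) (n : ℕ) : a ⊓ (n • b) = 0 := by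
  have ha : 0 ≤ a := h ▸ inf_le_left
  have hb : 0 ≤ b := h ▸ inf_le_right
  induction n with
  | zero => simpa using ha
  | succ n ih =>
    rw [succ_nsmul]
    exact inf_add_eq_zero ha (nsmul_nonneg hb n) hb ih h

theorem abs_le_of_le_of_neg_le {a b : E} (h : a ≤ b) (h' : -b ≤ a) : |a| ≤ b :=
  abs_le'.2 ⟨h, neg_le.1 h'⟩

theorem posPart_le_abs_self (a : E) : a⁺ ≤ |a| := sup_le (le_abs_self a) (abs_nonneg a)

theorem negPart_le_abs_self (a : E) : a⁻ ≤ |a| := sup_le (neg_le_abs a) (abs_nonneg a)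

/-- If every element of `s` is disjoint from `d`, so is the supremum of `s`. -/
theorem IsLUB.inf_eq_zero {s : Set E} {u d : E} (hs : s.Nonempty) (hu : IsLUB s u)
    (h : ∀ x ∈ s, x ⊓ d = 0) : u ⊓ d = 0 := by
  obtain ⟨x₀, hx₀⟩ := hs
  have hx : ∀ x ∈ s, 0 ≤ x := fun x hx => h x hx ▸ inf_le_left
  have hd : 0 ≤ d := h x₀ hx₀ ▸ inf_le_right
  have hu0 : 0 ≤ u := (hx x₀ hx₀).trans (hu.1 hx₀)
  refine le_antisymm ?_ (le_inf hu0 hd)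
  have : u ≤ u - u ⊓ d := hu.2 fun x hxs => by
    have e : x ⊓ (u ⊓ d) = 0 :=
      inf_eq_zero_mono (hx x hxs) (le_inf hu0 hd) le_rfl inf_le_right (h x hxs)
    have e2 := inf_add_sup x (u ⊓ d)
    rw [e, zero_add] at e2
    rw [le_sub_iff_add_le, ← e2]
    exact sup_le (hu.1 hxs) inf_le_left
  simpa using this

/-- Dedekind complete implies Archimedean: if `u` is the supremum of the multiples of `x`, then so
bounded is the shifted family, and `u - x` is still an upper bound. -/
theorem nonpos_of_forall_nsmul_le_of_lub
    (hE : IsDedekindComplete E) {x y : E}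
    (h : ∀ n : ℕ, n • x ≤ y) : x ≤ 0 := by
  obtain ⟨u, hu⟩ := hE (Set.range fun n : ℕ => n • x) (Set.range_nonempty _)
    ⟨y, by rintro _ ⟨n, rfl⟩; exact h n⟩
  have : u ≤ u - x := hu.2 (by
    rintro _ ⟨n, rfl⟩
    have := hu.1 ⟨n + 1, rfl⟩
    simp only [succ_nsmul] at this
    exact le_sub_iff_add_le.2 this)
  simpa using this

/-- Truncation: an element dominated by `a` splits into a part dominated by `(a - e)⁺` and a part
dominated by `e`. -/
theorem exists_add_eq_of_abs_le {u a e : E} (he : 0 ≤ e) (h : |u| ≤ a) :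
    ∃ v w, u = v + w ∧ |v| ≤ (a - e)⁺ ∧ |w| ≤ e := by
  have h1 : u ≤ a := (le_abs_self u).trans h
  have h2 : -u ≤ a := (neg_le_abs u).trans h
  have hee : -e ≤ e := (neg_nonpos.2 he).trans he
  refine ⟨u - (u ⊓ e ⊔ -e), u ⊓ e ⊔ -e, by abel, ?_, ?_⟩
  · refine abs_le_of_le_of_neg_le ?_ ?_
    · calc u - (u ⊓ e ⊔ -e) ≤ u - u ⊓ e := sub_le_sub_left le_sup_left _
        _ = (u - e)⁺ := by rw [inf_eq_sub_posPart_sub]; abel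
        _ ≤ (a - e)⁺ := posPart_mono (sub_le_sub_right h1 e)
    · have : u ⊓ e ⊔ -e ≤ u + (a - e)⁺ := by
        refine sup_le (inf_le_left.trans (le_add_of_nonneg_right (posPart_nonneg _))) ?_
        have := le_posPart (a - e)
        calc -e = -a + (a - e) := by abel
          _ ≤ u + (a - e)⁺ := add_le_add (neg_le.1 h2) this
      rw [neg_le, neg_sub, sub_le_iff_le_add, add_comm]
      exact this
  · exact abs_le_of_le_of_neg_le (sup_le inf_le_right hee) le_sup_right

end LatticeGroup

/-! ### Bands, band projections and band preserving operators. -/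

section DisjointComplement

variable {E : Type*} [AddCommGroup E] [Module ℝ E] [Lattice E] [IsOrderedAddMonoid E]
  [IsOrderedModule ℝ E]

theorem abs_smul_inf_eq_zero {a b : E} (h : |a| ⊓ b = 0) (t : ℝ) : |t • a| ⊓ b = 0 := by
  have hb : 0 ≤ b := h ▸ inf_le_right
  obtain ⟨n, hn⟩ := exists_nat_ge |t|
  obtain ⟨ht1, ht2⟩ := abs_le.1 hn
  have key : |t • a| ≤ n • |a| := by
    have hle : ∀ r : ℝ, |r| ≤ n → r • a ≤ n • |a| := by
      intro r hr
      obtain ⟨h1, h2⟩ := abs_le.1 hr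
      rw [← Nat.cast_smul_eq_nsmul ℝ]
      rcases le_total 0 r with h0 | h0
      · exact (smul_le_smul_of_nonneg_left (le_abs_self a) h0).trans
          (smul_le_smul_of_nonneg_right h2 (abs_nonneg a))
      · calc r • a = (-r) • (-a) := by simp
          _ ≤ (-r) • |a| := smul_le_smul_of_nonneg_left (neg_le_abs a) (by linarith)
          _ ≤ (n : ℝ) • |a| := smul_le_smul_of_nonneg_right (by linarith) (abs_nonneg a)
    refine abs_le'.2 ⟨hle t hn, ?_⟩
    rw [← neg_smul]
    exact hle (-t) (by rwa [abs_neg])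
  rw [inf_comm] at h ⊢
  exact inf_eq_zero_mono hb (abs_nonneg _) le_rfl key (inf_nsmul_eq_zero h n)

/-- The disjoint complement of a set in a Riesz space. -/
def disjointCompl (D : Set E) : Submodule ℝ E where
  carrier := {x | ∀ d ∈ D, |x| ⊓ |d| = 0}
  zero_mem' := fun d _ => by simp
  add_mem' := by
    intro a b ha hb d hd
    have := inf_add_eq_zero (abs_nonneg d) (abs_nonneg a) (abs_nonneg b)
      (by rw [inf_comm]; exact ha d hd) (by rw [inf_comm]; exact hb d hd)
    rw [inf_comm] at this
    exact inf_eq_zero_mono (abs_nonneg _) (abs_nonneg _) (abs_add_le a b) le_rfl this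
  smul_mem' := fun t a ha d hd => abs_smul_inf_eq_zero (ha d hd) t

theorem mem_disjointCompl {D : Set E} {x : E} :
    x ∈ disjointCompl D ↔ ∀ d ∈ D, |x| ⊓ |d| = 0 := Iff.rfl

theorem mem_disjointCompl_singleton {x y : E} :
    x ∈ disjointCompl {y} ↔ |x| ⊓ |y| = 0 := by simp [mem_disjointCompl]

theorem mem_disjointCompl_of_abs_le {D : Set E} {x y : E} (hx : x ∈ disjointCompl D)
    (h : |y| ≤ |x|) : y ∈ disjointCompl D := fun d hd =>
  inf_eq_zero_mono (abs_nonneg _) (abs_nonneg _) h le_rfl (hx d hd)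

theorem subset_disjointCompl_disjointCompl (D : Set E) :
    D ⊆ disjointCompl (disjointCompl D : Set E) := fun d hd x hx => by
  rw [inf_comm]; exact hx d hd

theorem abs_inf_abs_eq_zero {D : Set E} {x y : E} (hx : x ∈ disjointCompl D)
    (hy : y ∈ disjointCompl (disjointCompl D : Set E)) : |x| ⊓ |y| = 0 := by
  rw [inf_comm]; exact hy x hx

theorem eq_zero_of_abs_inf_abs_self {x : E} (h : |x| ⊓ |x| = 0) : x = 0 := by
  rw [inf_idem] at h
  exact le_antisymm (h ▸ le_abs_self x) (neg_nonpos.1 (h ▸ neg_le_abs x))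

theorem eq_zero_of_mem_disjointCompl {D : Set E} {x : E} (hx : x ∈ disjointCompl D)
    (hy : x ∈ disjointCompl (disjointCompl D : Set E)) : x = 0 :=
  eq_zero_of_abs_inf_abs_self (abs_inf_abs_eq_zero hx hy)

/-- Take `u` to be the largest element of `Dᵈ` below `f`. Any part of `f - u` meeting `Dᵈ` could be
added to `u`, contradicting maximality. -/
theorem exists_disjoint_decomposition (hE : IsDedekindComplete E) (D : Set E) {f : E} (hf : 0 ≤ f) :
    ∃ u ∈ disjointCompl D, 0 ≤ u ∧ u ≤ f ∧
      f - u ∈ disjointCompl (disjointCompl D : Set E) := by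
  set s : Set E := {x | x ∈ disjointCompl D ∧ 0 ≤ x ∧ x ≤ f}
  have hs0 : (0 : E) ∈ s := ⟨zero_mem _, le_rfl, hf⟩
  obtain ⟨u, hu⟩ := hE s ⟨0, hs0⟩ ⟨f, fun x hx => hx.2.2⟩
  have hu0 : 0 ≤ u := hu.1 hs0
  have huf : u ≤ f := hu.2 fun x hx => hx.2.2
  have huD : u ∈ disjointCompl D := fun d hd => by
    rw [abs_of_nonneg hu0]
    refine hu.inf_eq_zero ⟨0, hs0⟩ fun x hx => ?_
    have := hx.1 d hd
    rwa [abs_of_nonneg hx.2.1] at this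
  refine ⟨u, huD, hu0, huf, fun w hw => ?_⟩
  rw [abs_of_nonneg (sub_nonneg.2 huf)]
  set v := (f - u) ⊓ |w|
  have hv0 : 0 ≤ v := le_inf (sub_nonneg.2 huf) (abs_nonneg w)
  have hvD : v ∈ disjointCompl D := mem_disjointCompl_of_abs_le hw (by
    rw [abs_of_nonneg hv0]; exact inf_le_right)
  have : u + v ≤ u := hu.1 ⟨add_mem huD hvD, add_nonneg hu0 hv0, by
    rw [← le_sub_iff_add_le']; exact inf_le_left⟩
  exact le_antisymm (by simpa using this) hv0

theorem isCompl_disjointCompl (hE : IsDedekindComplete E) (D : Set E) :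
    IsCompl (disjointCompl (disjointCompl D : Set E)) (disjointCompl D) := by
  constructor
  · rw [Submodule.disjoint_def]
    exact fun x hx hy => eq_zero_of_mem_disjointCompl hy hx
  · rw [codisjoint_iff, Submodule.eq_top_iff']
    have key : ∀ f : E, 0 ≤ f →
        f ∈ disjointCompl (disjointCompl D : Set E) ⊔ disjointCompl D := fun f hf => by
      obtain ⟨u, hu, -, -, hfu⟩ := exists_disjoint_decomposition hE D hf
      rw [← sub_add_cancel f u]
      exact Submodule.add_mem_sup hfu hu
    intro f
    rw [← posPart_sub_negPart f]
    exact sub_mem (key _ (posPart_nonneg f)) (key _ (negPart_nonneg f))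

/-- The band projection onto `Dᵈᵈ`. -/
theorem exists_bandProjection (hE : IsDedekindComplete E) (D : Set E) : ∃ P : E →ₗ[ℝ] E,
    (∀ x, P x ∈ disjointCompl (disjointCompl D : Set E)) ∧
    (∀ x, x - P x ∈ disjointCompl D) ∧ (∀ x, 0 ≤ x → 0 ≤ P x) ∧ ∀ x, |P x| ≤ |x| := by
  have hc := isCompl_disjointCompl hE D
  set P := Submodule.projection _ _ hc
  have h1 : ∀ x, P x ∈ disjointCompl (disjointCompl D : Set E) := fun x =>
    Submodule.projection_apply_mem hc x
  have h2 : ∀ x, x - P x ∈ disjointCompl D := Submodule.sub_projection_mem hc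
  have h3 : ∀ x, 0 ≤ x → 0 ≤ P x ∧ P x ≤ x := fun x hx => by
    obtain ⟨u, hu, hu0, hux, hxu⟩ := exists_disjoint_decomposition hE D hx
    have e : P x = x - u := by
      rw [← sub_eq_zero]
      refine eq_zero_of_mem_disjointCompl (D := D) ?_ (sub_mem (h1 x) hxu)
      have := sub_mem hu (h2 x)
      rwa [show u - (x - P x) = P x - (x - u) by abel] at this
    rw [e]
    exact ⟨sub_nonneg.2 hux, sub_le_self _ hu0⟩
  refine ⟨P, h1, h2, fun x hx => (h3 x hx).1, fun x => ?_⟩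
  have hm : ∀ y, y ≤ |x| → P y ≤ |x| := fun y hy => by
    have := (h3 (|x| - y) (sub_nonneg.2 hy)).1
    rw [map_sub, sub_nonneg] at this
    exact this.trans (h3 _ (abs_nonneg x)).2
  refine abs_le'.2 ⟨hm x (le_abs_self x), ?_⟩
  rw [← map_neg]
  exact hm _ (neg_le_abs x)

/-- An order bounded band preserving operator on a Dedekind complete Riesz space is order
continuous. -/
theorem OrderTendstoZero.map_of_bandPreserving (hE : IsDedekindComplete E)
    {S : E →ₗ[ℝ] E} (hb : IsOrderBoundedMap S)
    (hS : ∀ x y : E, |x| ⊓ |y| = 0 → |S x| ⊓ |y| = 0) {ι : Type*} [Preorder ι] [Nonempty ι]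
    {x : ι → E} (hx : OrderTendstoZero x) : OrderTendstoZero fun i => S (x i) := by
  obtain ⟨y, hya, hy0, hxy⟩ := hx
  have hyn : ∀ i, 0 ≤ y i := fun i => hy0.1 ⟨i, rfl⟩
  -- The supremum `z` plays the role of `|S| a`; no modulus operator is constructed.
  have hlub : ∀ a : E, 0 ≤ a → ∃ z, IsLUB ((fun u => |S u|) '' {u | |u| ≤ a}) z := by
    intro a ha
    refine hE _ ⟨|S 0|, 0, by simpa using ha, rfl⟩ ?_
    obtain ⟨⟨l, hl⟩, m, hm⟩ := hb {u | |u| ≤ a}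
      ⟨-a, fun u hu => neg_le.1 ((neg_le_abs u).trans hu)⟩
      ⟨a, fun u hu => (le_abs_self u).trans hu⟩
    refine ⟨m ⊔ -l, ?_⟩
    rintro _ ⟨u, hu, rfl⟩
    exact sup_le_sup (hm ⟨u, hu, rfl⟩) (neg_le_neg (hl ⟨u, hu, rfl⟩))
  have h0 : ∀ {a z : E}, 0 ≤ a → IsLUB ((fun u => |S u|) '' {u | |u| ≤ a}) z → 0 ≤ z :=
    fun ha hz => (abs_nonneg (S 0)).trans (hz.1 ⟨0, by simpa using ha, rfl⟩)
  have hdis : ∀ {a z w : E}, 0 ≤ a → IsLUB ((fun u => |S u|) '' {u | |u| ≤ a}) z → 0 ≤ w →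
      a ⊓ w = 0 → z ⊓ w = 0 := by
    intro a z w ha hz hw haw
    refine IsLUB.inf_eq_zero (Set.Nonempty.image _ ⟨0, by simpa using ha⟩) hz ?_
    rintro _ ⟨u, hu, rfl⟩
    have := hS u w (inf_eq_zero_mono (abs_nonneg _) (abs_nonneg _) hu (abs_of_nonneg hw).le haw)
    rwa [abs_of_nonneg hw] at this
  choose z hz using fun i => hlub (y i) (hyn i)
  refine ⟨z, fun i j hij => ?_, ⟨?_, fun c hc => ?_⟩, fun i => (hz i).1 ⟨x i, hxy i, rfl⟩⟩
  · refine (hz j).2 ?_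
    rintro _ ⟨u, hu, rfl⟩
    exact (hz i).1 ⟨u, le_trans hu (hya hij), rfl⟩
  · rintro _ ⟨i, rfl⟩
    exact h0 (hyn i) (hz i)
  · obtain ⟨k⟩ := ‹Nonempty ι›
    have hc' : ∀ i, c ≤ z i := fun i => hc ⟨i, rfl⟩
    -- The excess `w` of `c` over `t • z k` is shown to be disjoint from `y k`, hence from `z k`;
    -- but `w ≤ z k`, so it vanishes.
    have main : ∀ t : ℝ, 0 < t → c ≤ t • z k := by
      intro t ht
      have hty : 0 ≤ t • y k := smul_nonneg ht.le (hyn k)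
      set w := (c - t • z k)⁺
      have hw : 0 ≤ w := posPart_nonneg _
      have hwd : ∀ i, w ⊓ (t • y k - y i)⁺ = 0 := by
        intro i
        obtain ⟨v, hv⟩ := hlub (y i - t • y k)⁺ (posPart_nonneg _)
        -- Truncating at `t • y k` splits `u` into a part controlled by `v`, the modulus at `(y i -
        -- t • y k)⁺`, and a part controlled by `t • z k`. Thus `w ≤ v`, and `v` is disjoint from
        -- `(t • y k - y i)⁺`.
        have hzv : z i ≤ v + t • z k := by
          refine (hz i).2 ?_
          rintro _ ⟨u, hu, rfl⟩
          obtain ⟨p, q, rfl, hp, hq⟩ := exists_add_eq_of_abs_le hty hu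
          simp only [map_add]
          refine (abs_add_le _ _).trans (add_le_add (hv.1 ⟨p, hp, rfl⟩) ?_)
          have hq' : |t⁻¹ • q| ≤ y k := by
            refine abs_le'.2 ⟨?_, ?_⟩
            · rw [inv_smul_le_iff_of_pos ht]; exact (le_abs_self q).trans hq
            · rw [← smul_neg, inv_smul_le_iff_of_pos ht]; exact (neg_le_abs q).trans hq
          have := (hz k).1 ⟨t⁻¹ • q, hq', rfl⟩
          simp only [map_smul] at this
          refine abs_le'.2 ⟨?_, ?_⟩
          · rw [← inv_smul_le_iff_of_pos ht]; exact (le_abs_self _).trans this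
          · rw [← inv_smul_le_iff_of_pos ht, smul_neg]; exact (neg_le_abs _).trans this
        have hwv : w ≤ v := sup_le (sub_le_iff_le_add.2 ((hc' i).trans hzv))
          (h0 (posPart_nonneg _) hv)
        refine inf_eq_zero_mono hw (posPart_nonneg _) hwv le_rfl
          (hdis (posPart_nonneg _) hv (posPart_nonneg _) ?_)
        rw [← neg_sub, posPart_neg, inf_comm]
        have := posPart_inf_negPart_eq_zero (t • y k - y i)
        rwa [← neg_sub, posPart_neg, negPart_neg, inf_comm] at this ⊢
      have hwy : w ⊓ (t • y k) = 0 := by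
        refine le_antisymm (hy0.2 ?_) (le_inf hw hty)
        rintro _ ⟨i, rfl⟩
        calc w ⊓ (t • y k) ≤ w ⊓ ((t • y k - y i)⁺ + y i) :=
              inf_le_inf_left _ (sub_le_iff_le_add.1 (le_posPart _))
          _ ≤ w ⊓ (t • y k - y i)⁺ + w ⊓ y i :=
              inf_add_le_of_nonneg hw (posPart_nonneg _) (hyn i)
          _ ≤ y i := by rw [hwd i, zero_add]; exact inf_le_right
      have hwy' : y k ⊓ w = 0 := by
        have := abs_smul_inf_eq_zero (a := t • y k) (b := w)
          (by rw [abs_of_nonneg hty, inf_comm]; exact hwy) t⁻¹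
        rwa [inv_smul_smul₀ ht.ne', abs_of_nonneg (hyn k)] at this
      have hzw := hdis (hyn k) (hz k) hw hwy'
      have hwz : w ≤ z k := sup_le ((sub_le_self _ (smul_nonneg ht.le (h0 (hyn k) (hz k)))).trans
        (hc' k)) (h0 (hyn k) (hz k))
      rw [inf_eq_right.2 hwz] at hzw
      have := le_posPart (c - t • z k)
      rw [show (c - t • z k)⁺ = 0 from hzw] at this
      exact sub_nonpos.1 this
    refine nonpos_of_forall_nsmul_le_of_lub hE (y := z k) fun n => ?_
    rcases n.eq_zero_or_pos with rfl | hn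
    · simpa using h0 (hyn k) (hz k)
    · have hn' : (0 : ℝ) < n := Nat.cast_pos.2 hn
      rw [← Nat.cast_smul_eq_nsmul ℝ, ← le_inv_smul_iff_of_pos hn']
      -- With `t = 1 / n` the bound reads `n • c ≤ z k`.
      exact main _ (inv_pos.2 hn')

end DisjointComplement

end

noncomputable section

set_option linter.unusedSectionVars false

/-! ### Monotone nets, evaluations and composition in the order dual. -/

namespace RieszDual

variable {E : Type*} [AddCommGroup E] [Module ℝ E] [Lattice E] [IsOrderedAddMonoid E]
  [IsOrderedModule ℝ E]

theorem apply_eq_posPart_sub_negPart (f : RieszDual E) (x : E) : f x = f x⁺ - f x⁻ := by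
  rw [← map_sub, posPart_sub_negPart]

theorem apply_mono {f : RieszDual E} (hf : 0 ≤ f) {x y : E} (h : x ≤ y) : f x ≤ f y := by
  have := hf (y - x) (sub_nonneg.2 h)
  rw [map_sub] at this
  simpa using this

theorem abs_apply_le_of_nonneg (f : RieszDual E) {x : E} (hx : 0 ≤ x) : |f x| ≤ |f| x :=
  abs_le'.2 ⟨le_abs_self f x hx, neg_le_abs f x hx⟩

theorem abs_apply_le (f : RieszDual E) (x : E) : |f x| ≤ |f| |x| := by
  rw [apply_eq_posPart_sub_negPart, ← posPart_add_negPart x, map_add]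
  exact (abs_sub _ _).trans (add_le_add (abs_apply_le_of_nonneg f (posPart_nonneg x))
    (abs_apply_le_of_nonneg f (negPart_nonneg x)))

/-- A monotone net in the order dual which is bounded above converges pointwise to its supremum. -/
theorem exists_tendsto_of_monotone {ι : Type*} [Preorder ι] [IsDirected ι (· ≤ ·)] [Nonempty ι]
    {F : ι → RieszDual E} (hF : Monotone F) (hb : BddAbove (Set.range F)) :
    ∃ φ : RieszDual E, (∀ x, Tendsto (fun i => F i x) atTop (𝓝 (φ x))) ∧
      IsLUB (Set.range F) φ := by
  obtain ⟨g, hg⟩ := hb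
  have hpos : ∀ x : E, 0 ≤ x → ∃ l, Tendsto (fun i => F i x) atTop (𝓝 l) := fun x hx =>
    ⟨_, tendsto_atTop_ciSup (fun i j hij => hF hij x hx)
      ⟨g x, by rintro _ ⟨i, rfl⟩; exact hg ⟨i, rfl⟩ x hx⟩⟩
  have hall : ∀ x : E, ∃ l, Tendsto (fun i => F i x) atTop (𝓝 l) := fun x => by
    obtain ⟨l, hl⟩ := hpos x⁺ (posPart_nonneg x)
    obtain ⟨m, hm⟩ := hpos x⁻ (negPart_nonneg x)
    refine ⟨l - m, (hl.sub hm).congr fun i => ?_⟩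
    exact (apply_eq_posPart_sub_negPart (F i) x).symm
  choose L hL using hall
  let φ : E →ₗ[ℝ] ℝ :=
    { toFun := L
      map_add' := fun x y => tendsto_nhds_unique (hL (x + y))
        (((hL x).add (hL y)).congr fun i => by rw [map_add])
      map_smul' := fun t x => tendsto_nhds_unique (hL (t • x))
        (((hL x).const_mul t).congr fun i => by rw [map_smul, smul_eq_mul]) }
  have hle : ∀ i (x : E), 0 ≤ x → F i x ≤ L x := fun i x hx =>
    ge_of_tendsto (hL x) (eventually_atTop.2 ⟨i, fun j hj => hF hj x hx⟩)
  obtain ⟨k⟩ := ‹Nonempty ι›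
  have hbd : IsOrderBoundedMap φ := by
    -- The limit dominates `F k`, so it is a positive functional plus an order bounded one.
    have h1 : IsOrderBoundedMap (φ - (F k).toLin) :=
      isOrderBoundedMap_of_nonneg _ fun x hx => by
        rw [LinearMap.sub_apply]
        exact sub_nonneg.2 (hle k x hx)
    have := (orderBoundedFunctionals E).add_mem (show φ - (F k).toLin ∈ _ from h1) (F k).2
    rwa [show φ - (F k).toLin + (F k).1 = φ from sub_add_cancel _ _] at this
  refine ⟨ofLin φ hbd, hL, ?_, fun h hh x hx => ?_⟩
  · rintro _ ⟨i, rfl⟩ x hx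
    exact hle i x hx
  · exact le_of_tendsto (hL x) (Eventually.of_forall fun i => hh ⟨i, rfl⟩ x hx)

variable (E) in
theorem isDedekindComplete : IsDedekindComplete (RieszDual E) := by
  intro s hs hb
  -- Closing `s` under finite suprema makes it directed without changing its upper bounds, so it can
  -- serve as a monotone net indexed by itself.
  set t := supClosure s
  have hne : Nonempty t := (hs.mono subset_supClosure).to_subtype
  have hdir : IsDirected t (· ≤ ·) := directedOn_iff_directed.1
    (supClosed_supClosure (s := s)).directedOn |> fun h => ⟨fun a b => h a b⟩
  obtain ⟨φ, -, hφ⟩ := exists_tendsto_of_monotone (F := fun f : t => f.1) (fun _ _ h => h)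
    (by rw [Subtype.range_coe]; exact hb.imp fun u hu => by rwa [upperBounds_supClosure])
  rw [Subtype.range_coe, isLUB_supClosure] at hφ
  exact ⟨φ, hφ⟩

theorem tendsto_apply_of_isGLB {ι : Type*} [Preorder ι] [IsDirected ι (· ≤ ·)] [Nonempty ι]
    {F : ι → RieszDual E} (hF : Antitone F) (h0 : IsGLB (Set.range F) 0) (x : E) :
    Tendsto (fun i => F i x) atTop (𝓝 0) := by
  have hub : ∀ i, -F i ≤ 0 := fun i => neg_nonpos.2 (h0.1 ⟨i, rfl⟩)
  obtain ⟨φ, h1, h2⟩ := exists_tendsto_of_monotone (F := fun i => -F i)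
    (fun i j h => neg_le_neg (hF h)) ⟨0, by rintro _ ⟨i, rfl⟩; exact hub i⟩
  have hφ : φ = 0 := by
    refine le_antisymm (h2.2 (by rintro _ ⟨i, rfl⟩; exact hub i)) ?_
    rw [← neg_nonpos]
    refine h0.2 ?_
    rintro _ ⟨i, rfl⟩
    exact neg_le.1 (h2.1 ⟨i, rfl⟩)
  subst hφ
  simpa using (h1 x).neg

/-- Evaluation at a point, as an element of the order bidual. -/
def eval (x : E) : RieszDual (RieszDual E) :=
  ofLin { toFun := fun f => f x, map_add' := fun _ _ => rfl, map_smul' := fun _ _ => rfl } (by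
    rintro s ⟨l, hl⟩ ⟨u, hu⟩
    have h : ∀ f ∈ s, ∃ p q, l x⁺ ≤ p ∧ p ≤ u x⁺ ∧ l x⁻ ≤ q ∧ q ≤ u x⁻ ∧ f x = p - q := fun f hf =>
      ⟨_, _, hl hf _ (posPart_nonneg x), hu hf _ (posPart_nonneg x), hl hf _ (negPart_nonneg x),
        hu hf _ (negPart_nonneg x), apply_eq_posPart_sub_negPart f x⟩
    constructor
    · refine ⟨l x⁺ - u x⁻, ?_⟩
      rintro _ ⟨f, hf, rfl⟩
      obtain ⟨p, q, h1, h2, h3, h4, h5⟩ := h f hf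
      change _ ≤ f x
      linarith
    · refine ⟨u x⁺ - l x⁻, ?_⟩
      rintro _ ⟨f, hf, rfl⟩
      obtain ⟨p, q, h1, h2, h3, h4, h5⟩ := h f hf
      change f x ≤ _
      linarith)

@[simp] theorem eval_apply (x : E) (f : RieszDual E) : eval x f = f x := rfl

theorem eval_mem_orderContinuousDual (x : E) : eval x ∈ orderContinuousDual (RieszDual E) := by
  intro ι _ _ _ F ⟨y, hy, hy0, hF⟩
  refine squeeze_zero_norm (fun i => ?_) (tendsto_apply_of_isGLB hy hy0 |x|)
  exact (abs_apply_le (F i) x).trans (hF i _ (abs_nonneg x))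

/-- The composition of an order bounded functional with an order bounded operator. -/
def compLin (F : RieszDual E) (S : E →ₗ[ℝ] E) (hS : IsOrderBoundedMap S) : RieszDual E :=
  ofLin (F.toLin ∘ₗ S) (F.isOrderBoundedMap.comp hS)

@[simp] theorem compLin_apply (F : RieszDual E) (S : E →ₗ[ℝ] E) (hS : IsOrderBoundedMap S)
    (x : E) : compLin F S hS x = F (S x) := rfl

theorem compLin_mem_orderContinuousDual {F : RieszDual E} (hF : F ∈ orderContinuousDual E)
    (hE : IsDedekindComplete E) {S : E →ₗ[ℝ] E} (hS : IsOrderBoundedMap S)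
    (hb : ∀ x y : E, |x| ⊓ |y| = 0 → |S x| ⊓ |y| = 0) :
    compLin F S hS ∈ orderContinuousDual E := fun ι _ _ _ _ hx =>
  hF ι _ (hx.map_of_bandPreserving hE hS hb)

end RieszDual

end

noncomputable section

set_option linter.unusedSectionVars false

variable {A : Type*} [NonUnitalRing A] [Module ℝ A] [IsScalarTower ℝ A A]
  [SMulCommClass ℝ A A] [Lattice A] [IsOrderedAddMonoid A] [IsOrderedModule ℝ A]

/-- The Archimedean property of `ℝ`, transported through positive functionals, which already
separate points. -/
theorem HasSeparatingOrderDual.eq_zero (hA : HasSeparatingOrderDual A) {d y : A}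
    (h : ∀ n : ℕ, n • d ≤ y) (h' : ∀ n : ℕ, n • (-d) ≤ y) : d = 0 := by
  have pos : ∀ f : RieszDual A, 0 ≤ f → f d = 0 := by
    intro f hf
    have key : ∀ c : A, (∀ n : ℕ, n • c ≤ y) → f c ≤ 0 := by
      intro c hc
      by_contra! hlt
      obtain ⟨n, hn⟩ := exists_nat_gt (f y / f c)
      rw [div_lt_iff₀ hlt] at hn
      have := RieszDual.apply_mono hf (hc n)
      rw [map_nsmul, nsmul_eq_mul] at this
      linarith
    have h1 := key d h
    have h2 := key (-d) h'
    rw [map_neg] at h2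
    linarith
  refine hA d fun f => ?_
  rw [← posPart_sub_negPart f, RieszDual.sub_apply, pos _ (posPart_nonneg f),
    pos _ (negPart_nonneg f), sub_zero]

/-! ### Commutativity and a quadratic estimate in `f`-algebras. -/

namespace IsFAlgebra

variable [IsFAlgebra A]

theorem mul_le_mul_left_of_nonneg {a b c : A} (hc : 0 ≤ c) (h : a ≤ b) : c * a ≤ c * b := by
  rw [← sub_nonneg, ← mul_sub]
  exact mul_nonneg _ _ hc (sub_nonneg.2 h)

theorem mul_le_mul_right_of_nonneg {a b c : A} (hc : 0 ≤ c) (h : a ≤ b) : a * c ≤ b * c := by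
  rw [← sub_nonneg, ← sub_mul]
  exact mul_nonneg _ _ (sub_nonneg.2 h) hc

/-- Multiplying each factor in turn makes `x * y` disjoint first from `y`, then from itself. -/
theorem mul_eq_zero_of_inf_eq_zero {x y : A} (h : x ⊓ y = 0) : x * y = 0 := by
  have hx : 0 ≤ x := h ▸ inf_le_left
  have hy : 0 ≤ y := h ▸ inf_le_right
  have h1 := mul_right_inf x y y h hy
  rw [inf_comm] at h1
  simpa using mul_left_inf y (x * y) x h1 hx

/-- Cut `n • a` into slices `c k` of height at most `e`. Since `c (k + 1)` is disjoint from `e - c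
k`, only `c k - c (k + 1)` contributes to `c k * (e - c k)`. The resulting bounds telescope, so the
commutator estimate is independent of `n`. -/
theorem nsmul_mul_sub_mul_le {a e : A} (ha : 0 ≤ a) (hae : a ≤ e) (n : ℕ) :
    n • (a * e - e * a) ≤ e * e ∧ n • (-(a * e - e * a)) ≤ e * e := by
  have he : 0 ≤ e := ha.trans hae
  set b : ℕ → A := fun k => (n • a - k • e)⁺
  set c : ℕ → A := fun k => b k ⊓ e
  have hb : ∀ k, 0 ≤ b k := fun k => posPart_nonneg _
  have hbs : ∀ k, b (k + 1) = (b k - e)⁺ := fun k => by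
    have e1 : n • a - (k + 1) • e = n • a - k • e - e := by rw [succ_nsmul]; abel
    have e2 : (n • a - k • e)⁺ - e = (n • a - k • e - e) ⊔ -e := by
      rw [posPart_def, sup_sub, zero_sub]
    change (n • a - (k + 1) • e)⁺ = ((n • a - k • e)⁺ - e)⁺
    rw [e1, e2, posPart_def, posPart_def, sup_assoc, sup_eq_right.2 (neg_nonpos.2 he)]
  have hc0 : ∀ k, 0 ≤ c k := fun k => le_inf (hb k) he
  have hce : ∀ k, c k ≤ e := fun k => inf_le_right
  have hcb : ∀ k, c k = b k - b (k + 1) := fun k => by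
    rw [hbs]; exact inf_eq_sub_posPart_sub _ _
  have hanti : ∀ k, c (k + 1) ≤ c k := fun k => by
    refine inf_le_inf_right _ ?_
    rw [hbs]
    exact sup_le (sub_le_self _ he) (hb k)
  have hbn : b n = 0 := by
    change (n • a - n • e)⁺ = 0
    rw [← nsmul_sub]
    exact posPart_of_nonpos (nsmul_nonpos (sub_nonpos.2 hae) n)
  have hcn : c n = 0 := by
    change b n ⊓ e = 0
    rw [hbn, inf_eq_left.2 he]
  have hsum : ∑ k ∈ Finset.range n, c k = n • a := by
    simp only [hcb]
    rw [Finset.sum_range_sub', hbn, sub_zero]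
    change (n • a - 0 • e)⁺ = n • a
    rw [zero_nsmul, sub_zero, posPart_of_nonneg (nsmul_nonneg ha n)]
  -- The two sides lie below the positive and negative parts of `n • a - (k + 1) • e`.
  have hdisj : ∀ k, c (k + 1) ⊓ (e - c k) = 0 := fun k => by
    refine inf_eq_zero_mono (hc0 _) (sub_nonneg.2 (hce k)) inf_le_left ?_
      (posPart_inf_negPart_eq_zero (n • a - (k + 1) • e))
    have : e - c k = (e - b k)⁺ := by
      change e - b k ⊓ e = _
      rw [inf_comm, inf_eq_sub_posPart_sub]; abel
    rw [this, ← posPart_neg]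
    refine posPart_mono ?_
    calc e - b k ≤ e - (n • a - k • e) := sub_le_sub_left (le_posPart _) _
      _ = -(n • a - (k + 1) • e) := by rw [succ_nsmul]; abel
  have hl : ∀ k, c k * (e - c k) ≤ (c k - c (k + 1)) * e := fun k => by
    have : c k * (e - c k) = (c k - c (k + 1)) * (e - c k) := by
      rw [sub_mul _ _ (e - c k), mul_eq_zero_of_inf_eq_zero (hdisj k), sub_zero]
    rw [this]
    exact mul_le_mul_left_of_nonneg (sub_nonneg.2 (hanti k)) (sub_le_self _ (hc0 k))
  have hr : ∀ k, (e - c k) * c k ≤ e * (c k - c (k + 1)) := fun k => by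
    have : (e - c k) * c k = (e - c k) * (c k - c (k + 1)) := by
      rw [mul_sub _ (c k), mul_eq_zero_of_inf_eq_zero (x := e - c k) (y := c (k + 1))
        (by rw [inf_comm]; exact hdisj k), sub_zero]
    rw [this]
    exact mul_le_mul_right_of_nonneg (sub_nonneg.2 (hanti k)) (sub_le_self _ (hc0 k))
  have hcomm : ∀ k, c k * e - e * c k = c k * (e - c k) - (e - c k) * c k := fun k => by
    rw [mul_sub, sub_mul]; abel
  have hlr : n • (a * e - e * a) = ∑ k ∈ Finset.range n, (c k * e - e * c k) := by
    rw [Finset.sum_sub_distrib, ← Finset.sum_mul, ← Finset.mul_sum, hsum, nsmul_sub,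
      smul_mul_assoc, mul_smul_comm]
  constructor
  · rw [hlr]
    calc ∑ k ∈ Finset.range n, (c k * e - e * c k)
        ≤ ∑ k ∈ Finset.range n, (c k - c (k + 1)) * e := Finset.sum_le_sum fun k _ => by
          rw [hcomm]
          exact (sub_le_self _ (mul_nonneg _ _ (sub_nonneg.2 (hce k)) (hc0 k))).trans (hl k)
      _ = c 0 * e := by rw [← Finset.sum_mul, Finset.sum_range_sub', hcn, sub_zero]
      _ ≤ e * e := mul_le_mul_right_of_nonneg he (hce 0)
  · rw [smul_neg, hlr, ← Finset.sum_neg_distrib]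
    calc ∑ k ∈ Finset.range n, -(c k * e - e * c k)
        ≤ ∑ k ∈ Finset.range n, e * (c k - c (k + 1)) := Finset.sum_le_sum fun k _ => by
          rw [hcomm, neg_sub]
          exact (sub_le_self _ (mul_nonneg _ _ (hc0 k) (sub_nonneg.2 (hce k)))).trans (hr k)
      _ = e * c 0 := by rw [← Finset.mul_sum, Finset.sum_range_sub', hcn, sub_zero]
      _ ≤ e * e := mul_le_mul_left_of_nonneg he (hce 0)

/-- An `f`-algebra whose order dual separates the points is commutative. -/
theorem mul_comm_of_separating (hA : HasSeparatingOrderDual A) (a b : A) : a * b = b * a := by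
  have pos : ∀ a b : A, 0 ≤ a → 0 ≤ b → a * b = b * a := by
    intro a b ha hb
    have h := hA.eq_zero
      (fun n => (nsmul_mul_sub_mul_le ha (le_add_of_nonneg_right hb : a ≤ a + b) n).1)
      (fun n => (nsmul_mul_sub_mul_le ha (le_add_of_nonneg_right hb : a ≤ a + b) n).2)
    rw [mul_add, add_mul, add_sub_add_left_eq_sub] at h
    exact sub_eq_zero.1 h
  rw [← posPart_sub_negPart a, ← posPart_sub_negPart b]
  simp only [sub_mul, mul_sub]
  rw [pos _ _ (posPart_nonneg a) (posPart_nonneg b), pos _ _ (posPart_nonneg a) (negPart_nonneg b),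
    pos _ _ (negPart_nonneg a) (posPart_nonneg b), pos _ _ (negPart_nonneg a) (negPart_nonneg b)]
  abel

/-- An operator form of `n a ≤ n² + a²`. With `d = n • x - a * x`, the difference of the two sides
lies below both `(a * d)⁺` and `n • d⁻`, which are disjoint because multiplication by `a` preserves
disjointness. -/
theorem nsmul_mul_le {a x : A} (ha : 0 ≤ a) (hx : 0 ≤ x) (n : ℕ) :
    n • (a * x) ≤ n • n • x + a * (a * x) := by
  set d := n • x - a * x
  have hax : 0 ≤ a * x := mul_nonneg _ _ ha hx
  have had : a * d = n • (a * x) - a * (a * x) := by rw [mul_sub, mul_smul_comm]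
  have h1 : (a * d)⁺ ⊓ d⁻ = 0 :=
    inf_eq_zero_mono (posPart_nonneg _) (negPart_nonneg _)
      (sup_le (mul_le_mul_left_of_nonneg ha (le_posPart d)) (mul_nonneg _ _ ha (posPart_nonneg d)))
      le_rfl (mul_left_inf _ _ a (posPart_inf_negPart_eq_zero d) ha)
  have h2 : n • (a * x) - (n • n • x + a * (a * x)) ≤ (a * d)⁺ := by
    refine le_trans ?_ (le_posPart _)
    rw [had]
    exact sub_le_sub_left (le_add_of_nonneg_left (nsmul_nonneg (nsmul_nonneg hx n) n)) _
  have h3 : n • (a * x) - (n • n • x + a * (a * x)) ≤ n • d⁻ := by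
    refine le_trans ?_ (nsmul_le_nsmul_right (neg_le_negPart d) n)
    rw [neg_sub, nsmul_sub]
    exact sub_le_sub_left (le_add_of_nonneg_right (mul_nonneg _ _ ha hax)) _
  have := le_inf h2 h3
  rw [inf_nsmul_eq_zero h1 n] at this
  exact sub_nonpos.1 this

end IsFAlgebra

/-! ### Band properties of the action of `A` on its order dual. -/

section DualMul

variable [IsFAlgebra A]

theorem dualMul_sub_left (f g : RieszDual A) (a : A) :
    dualMul (f - g) a = dualMul f a - dualMul g a := rfl

theorem dualMul_add_left (f g : RieszDual A) (a : A) :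
    dualMul (f + g) a = dualMul f a + dualMul g a := rfl

theorem dualMul_sub_right (f : RieszDual A) (a b : A) :
    dualMul f (a - b) = dualMul f a - dualMul f b := (dualMulLin f).map_sub a b

theorem dualMul_nonneg {f : RieszDual A} {a : A} (hf : 0 ≤ f) (ha : 0 ≤ a) : 0 ≤ dualMul f a :=
  fun x hx => hf (a * x) (IsFAlgebra.mul_nonneg _ _ ha hx)

theorem dualMul_mono_left {f g : RieszDual A} {a : A} (h : f ≤ g) (ha : 0 ≤ a) :
    dualMul f a ≤ dualMul g a :=
  fun x hx => h (a * x) (IsFAlgebra.mul_nonneg _ _ ha hx)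

/-- Reduction to positive functionals and positive elements by splitting both factors. -/
theorem dualMul_mem (M : Submodule ℝ (RieszDual A)) (f : RieszDual A) (a : A)
    (h : ∀ f' a', 0 ≤ f' → f' ≤ |f| → 0 ≤ a' → dualMul f' a' ∈ M) : dualMul f a ∈ M := by
  rw [← posPart_sub_negPart f, ← posPart_sub_negPart a]
  simp only [dualMul_sub_left, dualMul_sub_right]
  have hp := fun a' => h f⁺ a' (posPart_nonneg f) (posPart_le_abs_self f)
  have hn := fun a' => h f⁻ a' (negPart_nonneg f) (negPart_le_abs_self f)
  exact sub_mem (sub_mem (hp _ (posPart_nonneg a)) (hn _ (posPart_nonneg a)))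
    (sub_mem (hp _ (negPart_nonneg a)) (hn _ (negPart_nonneg a)))

theorem RieszDual.nonpos_of_forall_nsmul_le {f g : RieszDual A} (h : ∀ n : ℕ, n • f ≤ g) :
    f ≤ 0 :=
  nonpos_of_forall_nsmul_le_of_lub (RieszDual.isDedekindComplete A) h

/-- Put `g = f · a ⊓ h`. The quadratic estimate gives `n • g ≤ n² • f + (f · a) · a`; since `g ⊥ f`,
the first summand drops out, and the remaining bound is independent of `n`. -/
theorem dualMul_inf_eq_zero_of_nonneg {f h : RieszDual A} {a : A} (hfh : f ⊓ h = 0)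
    (ha : 0 ≤ a) : dualMul f a ⊓ h = 0 := by
  have hf : 0 ≤ f := hfh ▸ inf_le_left
  have hh : 0 ≤ h := hfh ▸ inf_le_right
  set g := dualMul f a ⊓ h
  have hg : 0 ≤ g := le_inf (dualMul_nonneg hf ha) hh
  refine le_antisymm (RieszDual.nonpos_of_forall_nsmul_le
    (g := dualMul (dualMul f a) a) fun n => ?_) hg
  have hq : 0 ≤ dualMul (dualMul f a) a := dualMul_nonneg (dualMul_nonneg hf ha) ha
  have hng : 0 ≤ n • g := nsmul_nonneg hg n
  have h1 : n • dualMul f a ≤ n • n • f + dualMul (dualMul f a) a := fun x hx => by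
    have := RieszDual.apply_mono hf (IsFAlgebra.nsmul_mul_le ha hx n)
    simp only [map_add, map_nsmul] at this
    simp only [← Nat.cast_smul_eq_nsmul ℝ, RieszDual.add_apply, RieszDual.smul_apply,
      dualMul_apply] at this ⊢
    exact this
  have h2 : n • g ≤ n • n • f + dualMul (dualMul f a) a :=
    (nsmul_le_nsmul_right inf_le_left n).trans h1
  have h3 : f ⊓ g = 0 := inf_eq_zero_mono hf hg le_rfl inf_le_right hfh
  have h4 : (n • g) ⊓ (n • n • f) = 0 := by
    refine inf_nsmul_eq_zero (inf_nsmul_eq_zero ?_ n) n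
    rw [inf_comm]
    exact inf_nsmul_eq_zero h3 n
  calc n • g = (n • g) ⊓ (n • n • f + dualMul (dualMul f a) a) := (inf_eq_left.2 h2).symm
    _ ≤ (n • g) ⊓ (n • n • f) + (n • g) ⊓ dualMul (dualMul f a) a :=
      inf_add_le_of_nonneg hng (nsmul_nonneg (nsmul_nonneg hf n) n) hq
    _ ≤ dualMul (dualMul f a) a := by rw [h4, zero_add]; exact inf_le_right

theorem abs_dualMul_inf_abs_eq_zero {f h : RieszDual A} (hfh : |f| ⊓ |h| = 0) (a : A) :
    |dualMul f a| ⊓ |h| = 0 := by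
  refine mem_disjointCompl_singleton.1 (dualMul_mem _ f a fun f' a' hf hff ha => ?_)
  rw [mem_disjointCompl_singleton, abs_of_nonneg (dualMul_nonneg hf ha)]
  exact dualMul_inf_eq_zero_of_nonneg (inf_eq_zero_mono hf (abs_nonneg h) hff le_rfl hfh) ha

theorem dualMul_mem_disjointCompl {D : Set (RieszDual A)} {f : RieszDual A}
    (hf : f ∈ disjointCompl D) (a : A) : dualMul f a ∈ disjointCompl D :=
  fun d hd => abs_dualMul_inf_abs_eq_zero (hf d hd) a

/-- The functionals `u⁺ · a` and `u⁻ · a` are both disjoint and equal. -/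
theorem dualMul_abs_eq_zero {u : RieszDual A} (hu : ∀ a, dualMul u a = 0) {a : A} (ha : 0 ≤ a) :
    dualMul |u| a = 0 := by
  have h1 : dualMul u⁺ a ⊓ dualMul u⁻ a = 0 := by
    have := dualMul_inf_eq_zero_of_nonneg (posPart_inf_negPart_eq_zero u) ha
    rw [inf_comm] at this ⊢
    exact dualMul_inf_eq_zero_of_nonneg this ha
  have h2 : dualMul u⁺ a = dualMul u⁻ a := by
    rw [← sub_eq_zero, ← dualMul_sub_left, posPart_sub_negPart, hu]
  rw [h2, inf_idem] at h1
  rw [← posPart_add_negPart u, dualMul_add_left, h2, h1, add_zero]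

/-- For `m = f · a ⊓ k`, subtracting `n • m` from `f` does not change the action of `a`. Hence `m`
lies below `(f - n • m)⁺ · a` and is disjoint from `(f - n • m)⁻`. As that negative part is at most
`n • m`, it vanishes, so `n • m ≤ f` for all `n`. -/
theorem dualMul_inf_eq_zero_of_annihilator {f k : RieszDual A} {a : A} (hf : 0 ≤ f) (hk : 0 ≤ k)
    (ha : 0 ≤ a) (hka : dualMul k a = 0) : dualMul f a ⊓ k = 0 := by
  set m := dualMul f a ⊓ k
  have hm : 0 ≤ m := le_inf (dualMul_nonneg hf ha) hk
  have hma : dualMul m a = 0 :=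
    le_antisymm (hka ▸ dualMul_mono_left inf_le_right ha) (dualMul_nonneg hm ha)
  refine le_antisymm (RieszDual.nonpos_of_forall_nsmul_le (g := f) fun n => ?_) hm
  have hnm : 0 ≤ n • m := nsmul_nonneg hm n
  have hnma : dualMul (n • m) a = 0 := by
    have : dualMul (n • m) a = n • dualMul m a := RieszDual.ext fun x => by
      simp [← Nat.cast_smul_eq_nsmul ℝ]
    rw [this, hma, nsmul_zero]
  have h1 : dualMul f a ≤ dualMul (f - n • m)⁺ a := by
    have := dualMul_mono_left (sub_le_iff_le_add.1 (le_posPart (f - n • m))) ha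
    rwa [dualMul_add_left, hnma, add_zero] at this
  have h2 : (f - n • m)⁻ ⊓ m = 0 := by
    rw [inf_comm]
    exact inf_eq_zero_mono hm (negPart_nonneg _) (inf_le_left.trans h1) le_rfl
      (dualMul_inf_eq_zero_of_nonneg (posPart_inf_negPart_eq_zero (f - n • m)) ha)
  have h3 : (f - n • m)⁻ ≤ n • m := by
    refine sup_le ?_ hnm
    rw [neg_sub]
    exact sub_le_self _ hf
  have h4 := inf_nsmul_eq_zero h2 n
  rw [inf_eq_left.2 h3] at h4
  have := neg_le_negPart (f - n • m)
  rw [h4, neg_sub] at this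
  exact sub_nonpos.1 this

/-- The functionals `f · a`. -/
def dualMulRange (A : Type*) [NonUnitalRing A] [Module ℝ A] [IsScalarTower ℝ A A]
    [SMulCommClass ℝ A A] [Lattice A] [IsOrderedAddMonoid A] [IsOrderedModule ℝ A]
    [IsFAlgebra A] : Set (RieszDual A) := {g | ∃ f a, g = dualMul f a}

theorem mem_disjointCompl_dualMulRange {u : RieszDual A} (hu : ∀ a, dualMul u a = 0) :
    u ∈ disjointCompl (dualMulRange A) := by
  rintro _ ⟨f, a, rfl⟩
  rw [inf_comm]
  refine mem_disjointCompl_singleton.1 (dualMul_mem _ f a fun f' a' hf _ ha => ?_)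
  rw [mem_disjointCompl_singleton, abs_of_nonneg (dualMul_nonneg hf ha)]
  exact dualMul_inf_eq_zero_of_annihilator hf (abs_nonneg u) ha (dualMul_abs_eq_zero hu ha)

/-- The two sides at `b` are `f (b * a)` and `f (a * b)`; this is where commutativity enters. -/
theorem bidualMul_eval (hA : HasSeparatingOrderDual A) (f : RieszDual A) (a : A) :
    bidualMul (RieszDual.eval a) f = dualMul f a :=
  RieszDual.ext fun b => by
    rw [bidualMul_apply, RieszDual.eval_apply, dualMul_apply, dualMul_apply,
      IsFAlgebra.mul_comm_of_separating hA]

/-- If `P` is the band projection onto the band generated by the functionals `f · a`, then `P ∘ T`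
is band preserving for every operator `T` which is `f`-linear. -/
theorem bandPreserving_comp_of_mem_fLinearOperators {T P : RieszDual A →ₗ[ℝ] RieszDual A}
    (hT : T ∈ fLinearOperators A)
    (hP : ∀ x, P x ∈ disjointCompl (disjointCompl (dualMulRange A) : Set (RieszDual A)))
    (hP' : ∀ x, x - P x ∈ disjointCompl (dualMulRange A)) {f g : RieszDual A}
    (hfg : |f| ⊓ |g| = 0) : |(P ∘ₗ T) f| ⊓ |g| = 0 := by
  rw [LinearMap.comp_apply]
  set h := |P (T f)| ⊓ |g|
  have hh : 0 ≤ h := le_inf (abs_nonneg _) (abs_nonneg _)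
  have hhD : h ∈ disjointCompl (disjointCompl (dualMulRange A) : Set (RieszDual A)) :=
    mem_disjointCompl_of_abs_le (hP (T f)) (by rw [abs_of_nonneg hh]; exact inf_le_left)
  have hfh : f ∈ disjointCompl {h} := mem_disjointCompl_singleton.2
    (inf_eq_zero_mono (abs_nonneg f) (abs_nonneg h) le_rfl
      (by rw [abs_of_nonneg hh]; exact inf_le_right) hfg)
  obtain ⟨Q, hQ, hQ', hQ0, hQabs⟩ :=
    exists_bandProjection (RieszDual.isDedekindComplete A) ({h} : Set (RieszDual A))
  have hQob : IsOrderBoundedMap Q := RieszDual.isOrderBoundedMap_of_nonneg Q hQ0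
  have hQz : ∀ x ∈ disjointCompl {h}, Q x = 0 := fun x hx =>
    eq_zero_of_mem_disjointCompl (D := {h})
      (mem_disjointCompl_of_abs_le hx (hQabs x)) (hQ x)
  have hQT : ∀ a, dualMul (Q (T f)) a = 0 := by
    intro a
    refine RieszDual.ext fun b => ?_
    set F := (RieszDual.eval b).compLin Q hQob
    have hF : F ∈ orderContinuousDual (RieszDual A) :=
      RieszDual.compLin_mem_orderContinuousDual (RieszDual.eval_mem_orderContinuousDual b)
        (RieszDual.isDedekindComplete A) hQob fun x y hxy =>
        inf_eq_zero_mono (abs_nonneg _) (abs_nonneg _) (hQabs x) le_rfl hxy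
    have hFf : bidualMul F f = 0 := RieszDual.ext fun c => by
      rw [bidualMul_apply, RieszDual.compLin_apply, hQz _ (dualMul_mem_disjointCompl hfh c)]
      simp
    have h1 := hT.2 f F hF
    rw [hFf, map_zero] at h1
    have h2 : Q (dualMul (T f) a) b = 0 := by
      change bidualMul F (T f) a = 0
      rw [← h1, RieszDual.zero_apply]
    -- The action of `a` preserves both bands of the decomposition, so it commutes with `Q`.
    have h3 : Q (dualMul (T f) a) = dualMul (Q (T f)) a := by
      rw [← sub_eq_zero]
      refine eq_zero_of_mem_disjointCompl (D := {h}) ?_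
        (sub_mem (hQ _) (dualMul_mem_disjointCompl (hQ _) a))
      have := sub_mem (dualMul_mem_disjointCompl (hQ' (T f)) a) (hQ' (dualMul (T f) a))
      rw [dualMul_sub_left] at this
      convert this using 1
      abel
    rw [← h3, h2, RieszDual.zero_apply]
  have hQ0' : Q (T f) = 0 := by
    refine eq_zero_of_mem_disjointCompl (D := {h}) ?_ (hQ _)
    rw [mem_disjointCompl_singleton]
    exact abs_inf_abs_eq_zero (mem_disjointCompl_dualMulRange hQT) hhD
  have hTf : T f ∈ disjointCompl {h} := by
    have := hQ' (T f)
    rwa [hQ0', sub_zero] at this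
  have hPTf : P (T f) ∈ disjointCompl {h} := by
    have : T f - P (T f) ∈ disjointCompl {h} :=
      mem_disjointCompl_singleton.2 (abs_inf_abs_eq_zero (hP' _) hhD)
    have := sub_mem hTf this
    rwa [sub_sub_cancel] at this
  have := mem_disjointCompl_singleton.1 hPTf
  -- Since `h ≤ |P (T f)|`, disjointness of the two means `h = 0`.
  rw [abs_of_nonneg hh] at this
  rwa [inf_eq_right.2 inf_le_left] at this

end DualMul

end

/-! ### The main theorem. -/

theorem theorem3p3 (A : Type*) [NonUnitalRing A] [Module ℝ A] [IsScalarTower ℝ A A]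
    [SMulCommClass ℝ A A] [Lattice A] [IsOrderedAddMonoid A] [IsOrderedModule ℝ A]
    [IsFAlgebra A] (hA : HasSeparatingOrderDual A) :
    fLinearOperators A ⊆ fOrthomorphisms A := by
  intro T hT
  refine ⟨hT.1, fun f => ?_⟩
  rintro _ ⟨G, hG, rfl⟩
  obtain ⟨P, hP, hP', hP0, -⟩ :=
    exists_bandProjection (RieszDual.isDedekindComplete A) (dualMulRange A)
  have hPT : IsOrderBoundedMap (P ∘ₗ T) :=
    (RieszDual.isOrderBoundedMap_of_nonneg P hP0).comp hT.1
  -- The witness for `G · T f ∈ R(f)` is `G ∘ P ∘ T`; the projection secures order continuity and is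
  -- invisible on `(T f) · a`.
  refine ⟨G.compLin (P ∘ₗ T) hPT, RieszDual.compLin_mem_orderContinuousDual hG
    (RieszDual.isDedekindComplete A) hPT fun x y hxy =>
      bandPreserving_comp_of_mem_fLinearOperators hT hP hP' hxy, RieszDual.ext fun a => ?_⟩
  have h1 : T (dualMul f a) = dualMul (T f) a := by
    rw [← bidualMul_eval hA, ← bidualMul_eval hA]
    exact hT.2 f _ (RieszDual.eval_mem_orderContinuousDual a)
  have h2 : P (dualMul (T f) a) = dualMul (T f) a := by
    refine (sub_eq_zero.1 (eq_zero_of_mem_disjointCompl (hP' _) (sub_mem ?_ (hP _)))).symm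
    exact subset_disjointCompl_disjointCompl _ ⟨T f, a, rfl⟩
  rw [bidualMul_apply, bidualMul_apply, RieszDual.compLin_apply, LinearMap.comp_apply, h1, h2]
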